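/- Let $k$ be a field, $m\ge 0$, $R=k[x_1,\ldots,x_m]$ and $\mathfrak m=(x_1,\ldots,x_m)$, and regard $k=R/\mathfrak m$ as an $R$-module. Let $I\subsetneq R$ be a proper monomial ideal, i.e. a proper ideal generated by a (possibly empty) set of monomials. Then $I$ is of small type: for every $s\ge 1$ and every $i\ge 0$, the map $$\operatorname{Tor}^R_i(k,I^s)\longrightarrow \operatorname{Tor}^R_i(k,I^{s-1})$$ induced by the inclusion $I^s\subseteq I^{s-1}$ (with $I^0=R$) is zero. -/

import Mathlib

open CategoryTheory

universe u

noncomputable section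

namespace SmallType

/-- The graded maximal ideal `(x₁, …, xₘ)` of `k[x₁, …, xₘ]`. -/
def gradedMaximalIdeal (k : Type u) [Field k] (m : ℕ) : Ideal (MvPolynomial (Fin m) k) :=
  Ideal.span (Set.range MvPolynomial.X)

/-- The residue field `k = R / (x₁, …, xₘ)` as a module over `R = k[x₁, …, xₘ]`. -/
abbrev residueModule (k : Type u) [Field k] (m : ℕ) : ModuleCat.{u} (MvPolynomial (Fin m) k) :=
  ModuleCat.of (MvPolynomial (Fin m) k) (MvPolynomial (Fin m) k ⧸ gradedMaximalIdeal k m)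

/-- A homomorphism `φ : M → P` of `k[x₁, …, xₘ]`-modules is Tor-vanishing if
`Tor_i(k, φ) : Tor_i(k, M) → Tor_i(k, P)` is zero for all `i ≥ 0`. -/
def IsTorVanishing {k : Type u} [Field k] {m : ℕ} {M P : Type u}
    [AddCommGroup M] [Module (MvPolynomial (Fin m) k) M]
    [AddCommGroup P] [Module (MvPolynomial (Fin m) k) P]
    (φ : M →ₗ[MvPolynomial (Fin m) k] P) : Prop :=
  ∀ i : ℕ, ((Tor (ModuleCat.{u} (MvPolynomial (Fin m) k)) i).obj (residueModule k m)).map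
    (ModuleCat.ofHom φ) = 0

/-- An ideal is of small type if the inclusion `I ^ s → I ^ (s - 1)` is Tor-vanishing for
all `s ≥ 1`. -/
def IsOfSmallType {k : Type u} [Field k] {m : ℕ} (I : Ideal (MvPolynomial (Fin m) k)) : Prop :=
  ∀ s : ℕ, 1 ≤ s →
    IsTorVanishing (Submodule.inclusion (Ideal.pow_le_pow_right (Nat.sub_le s 1) :
      I ^ s ≤ I ^ (s - 1)))

/-- A monomial ideal is an ideal generated by a set of monomials. -/
def IsMonomialIdeal {k : Type u} [Field k] {m : ℕ} (I : Ideal (MvPolynomial (Fin m) k)) : Prop :=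
  ∃ A : Set (Fin m →₀ ℕ), I = Ideal.span ((fun a => MvPolynomial.monomial a (1 : k)) '' A)

end SmallType

end

/-!
Let `K` be the Koszul complex `R ⊗ Λ(k^σ)` of the variables, a flat resolution of `R ⧸ 𝔪`. Dividing
by `x_j` and wedging with `e_j` is a `k`-linear homotopy from the identity of `K` to the projection
`p_j` onto the part of `K` involving neither `x_j` nor `e_j`. Every element of `𝔪 K`, and every
element of positive degree, is killed by the product of all the `p_j`, so a cycle of either kind is
the boundary of an element which the homotopies write down. If `I` is a monomial ideal and a product
of monomials, `s` of them in `I`, is divisible by `x_j`, the division affects a single factor and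
hence leaves a product of `s - 1` monomials in `I`. So the homotopies map `I ^ s K` to
`I ^ (s - 1) K`, and a cycle of `I ^ s K` is a boundary in `I ^ (s - 1) K`. Dimension shifting along
`K` turns this into the vanishing of the map on `Tor`.
-/

universe v w

open TensorProduct

noncomputable section

namespace SmallType

section Balancing

open HomologicalComplex Limits

variable {R : Type w} [CommRing R]

lemma homologyMap_eq_zero {C D : ChainComplex (ModuleCat.{w} R) ℕ} (g : C ⟶ D) (n : ℕ)
    (h : ∀ x : C.X n, (∀ j, C.d n j x = 0) → ∃ y : D.X (n + 1), D.d (n + 1) n y = g.f n x) :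
    homologyMap g n = 0 := by
  rw [← cancel_epi (C.homologyπ n), homologyπ_naturality, comp_zero]
  ext x
  obtain ⟨y, hy⟩ := h (C.iCycles n x) fun j => ConcreteCategory.congr_hom (C.iCycles_d n j) x
  have hcycles : cyclesMap g n x = D.toCycles (n + 1) n y := by
    refine (ModuleCat.mono_iff_injective (D.iCycles n)).1 inferInstance ?_
    rw [← ConcreteCategory.comp_apply, ← ConcreteCategory.comp_apply, cyclesMap_i, toCycles_i,
      ConcreteCategory.comp_apply, hy]
  rw [ConcreteCategory.comp_apply, hcycles, ← ConcreteCategory.comp_apply,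
    toCycles_comp_homologyπ]
  rfl

/-- The chain map `C ⊗ g` sends every cycle of degree `i` to a boundary. This elementwise form of
the vanishing of `H_i(C ⊗ g)` is what dimension shifting in `C` manipulates. -/
def TensorCyclesToBoundaries (C : Type w) [AddCommGroup C] [Module R C]
    {K K' : ChainComplex (ModuleCat.{w} R) ℕ} (g : K ⟶ K') (i : ℕ) : Prop :=
  ∀ x : C ⊗[R] K.X i, (∀ j, (K.d i j).hom.lTensor C x = 0) →
    ∃ y : C ⊗[R] K'.X (i + 1), (K'.d (i + 1) i).hom.lTensor C y = (g.f i).hom.lTensor C x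

section DimensionShift

variable {K K' : ChainComplex (ModuleCat.{w} R) ℕ} (g : K ⟶ K') {i : ℕ}
  {A B C : Type w} [AddCommGroup A] [Module R A] [AddCommGroup B] [Module R B]
  [AddCommGroup C] [Module R C] {f : A →ₗ[R] B} {p : B →ₗ[R] C}

lemma lTensor_d_lTensor_f (C : Type w) [AddCommGroup C] [Module R C] (i j : ℕ)
    (x : C ⊗[R] K.X i) :
    (K'.d i j).hom.lTensor C ((g.f i).hom.lTensor C x) =
      (g.f j).hom.lTensor C ((K.d i j).hom.lTensor C x) := by
  simp only [← LinearMap.lTensor_comp_apply, ← ModuleCat.hom_comp, g.comm]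

lemma lTensor_rTensor_comm {M N : Type w} [AddCommGroup M] [Module R M] [AddCommGroup N]
    [Module R N] (f : A →ₗ[R] B) (e : M →ₗ[R] N) (x : A ⊗[R] M) :
    e.lTensor B (f.rTensor M x) = f.rTensor N (e.lTensor A x) := by
  rw [← LinearMap.comp_apply, LinearMap.lTensor_comp_rTensor, ← LinearMap.rTensor_comp_lTensor,
    LinearMap.comp_apply]

/-- Dimension shift along `A → B → C`: a lift to `B` of a cycle is mapped to a cycle after
subtracting the element of `A` that `h` provides. -/
lemma TensorCyclesToBoundaries.of_exact [Module.Flat R B] (hfp : Function.Exact f p)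
    (hp : Function.Surjective p)
    (hK' : Function.Exact (K'.d (i + 2) (i + 1)).hom (K'.d (i + 1) i).hom)
    (h : ∀ (a : A ⊗[R] K.X i) (b : B ⊗[R] K.X (i + 1)),
      f.rTensor _ a = (K.d (i + 1) i).hom.lTensor B b →
        ∃ a' : A ⊗[R] K'.X (i + 1),
          (K'.d (i + 1) i).hom.lTensor A a' = (g.f i).hom.lTensor A a) :
    TensorCyclesToBoundaries C g (i + 1) := by
  intro x hx
  obtain ⟨b, rfl⟩ := LinearMap.rTensor_surjective (K.X (i + 1)) hp x
  obtain ⟨a, ha⟩ : ∃ a, f.rTensor _ a = (K.d (i + 1) i).hom.lTensor B b :=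
    (rTensor_exact (K.X i) hfp hp _).1 (by rw [← lTensor_rTensor_comm, hx])
  obtain ⟨a', ha'⟩ := h a b ha
  obtain ⟨b', hb'⟩ := (Module.Flat.lTensor_exact B hK'
      ((g.f (i + 1)).hom.lTensor B b - f.rTensor _ a')).1 (by
    rw [map_sub, lTensor_d_lTensor_f, ← ha, lTensor_rTensor_comm, lTensor_rTensor_comm, ha',
      sub_self])
  refine ⟨p.rTensor _ b', ?_⟩
  rw [lTensor_rTensor_comm, hb', map_sub, lTensor_rTensor_comm,
    (rTensor_exact (K'.X (i + 1)) hfp hp).apply_apply_eq_zero, sub_zero]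

lemma TensorCyclesToBoundaries.succ [Module.Flat R B] (hflat : ∀ j, Module.Flat R (K.X j))
    (hf : Function.Injective f) (hfp : Function.Exact f p) (hp : Function.Surjective p)
    (hK' : Function.Exact (K'.d (i + 2) (i + 1)).hom (K'.d (i + 1) i).hom)
    (h : TensorCyclesToBoundaries A g i) : TensorCyclesToBoundaries C g (i + 1) := by
  refine .of_exact g hfp hp hK' fun a b hab => h a fun j => ?_
  have := hflat j
  apply Module.Flat.rTensor_preserves_injective_linearMap (M := K.X j) f hf
  rw [← lTensor_rTensor_comm, hab, ← LinearMap.lTensor_comp_apply, ← ModuleCat.hom_comp,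
    K.d_comp_d, ModuleCat.hom_zero, LinearMap.lTensor_zero, LinearMap.zero_apply, map_zero]

end DimensionShift

section Augmentation

variable {K K' : ChainComplex (ModuleCat.{w} R) ℕ} (g : K ⟶ K')
  {M N : Type w} [AddCommGroup M] [Module R M] [AddCommGroup N] [Module R N]
  {ε : K.X 0 →ₗ[R] M} {ε' : K'.X 0 →ₗ[R] N} {φ : M →ₗ[R] N}
  {A B C : Type w} [AddCommGroup A] [Module R A] [AddCommGroup B] [Module R B]
  [AddCommGroup C] [Module R C] {f : A →ₗ[R] B} {p : B →ₗ[R] C}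

lemma exists_lTensor_d_eq (hε' : Function.Surjective ε')
    (hexact : Function.Exact (K'.d 1 0).hom ε') (hφ : ε' ∘ₗ (g.f 0).hom = φ ∘ₗ ε)
    {x : C ⊗[R] K.X 0} (hx : φ.lTensor C (ε.lTensor C x) = 0) :
    ∃ y : C ⊗[R] K'.X 1, (K'.d 1 0).hom.lTensor C y = (g.f 0).hom.lTensor C x :=
  (lTensor_exact C hexact hε' _).1 <| by
    rw [← LinearMap.lTensor_comp_apply, hφ, LinearMap.lTensor_comp_apply, hx]

lemma TensorCyclesToBoundaries.zero (hε' : Function.Surjective ε')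
    (hexact : Function.Exact (K'.d 1 0).hom ε') (hφ : ε' ∘ₗ (g.f 0).hom = φ ∘ₗ ε)
    (h : φ.lTensor C = 0) : TensorCyclesToBoundaries C g 0 := fun x _ =>
  exists_lTensor_d_eq g hε' hexact hφ (by rw [h, LinearMap.zero_apply])

lemma TensorCyclesToBoundaries.one [Module.Flat R B] (hε' : Function.Surjective ε')
    (hεd : ε ∘ₗ (K.d 1 0).hom = 0)
    (hexact : Function.Exact (K'.d 1 0).hom ε') (hφ : ε' ∘ₗ (g.f 0).hom = φ ∘ₗ ε)
    (hfp : Function.Exact f p) (hp : Function.Surjective p)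
    (hK' : Function.Exact (K'.d 2 1).hom (K'.d 1 0).hom)
    (h : ∀ x : A ⊗[R] M, f.rTensor M x = 0 → φ.lTensor A x = 0) :
    TensorCyclesToBoundaries C g 1 := by
  refine .of_exact g hfp hp hK' fun a b hab => exists_lTensor_d_eq g hε' hexact hφ (h _ ?_)
  rw [← lTensor_rTensor_comm, hab, ← LinearMap.lTensor_comp_apply, hεd, LinearMap.lTensor_zero,
    LinearMap.zero_apply]

end Augmentation

section Tor

variable {M N : ModuleCat.{w} R} (P : ProjectiveResolution M) (Q : ProjectiveResolution N)

lemma flat_projectiveResolution (j : ℕ) : Module.Flat R (P.complex.X j) :=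
  have : Module.Projective R (P.complex.X j) :=
    (IsProjective.iff_projective (P.complex.X j)).2 (P.projective j)
  inferInstance

lemma exact_projectiveResolution (j : ℕ) :
    Function.Exact (P.complex.d (j + 2) (j + 1)).hom (P.complex.d (j + 1) j).hom :=
  (ShortComplex.ShortExact.moduleCat_exact_iff_function_exact _).1 (P.exact_succ j)

/-- The augmentation of a projective resolution, as a linear map from its term of degree `0`. -/
def augmentation : P.complex.X 0 →ₗ[R] M :=
  (P.π.f 0).hom

lemma augmentation_surjective : Function.Surjective (augmentation P) :=
  (ModuleCat.epi_iff_surjective _).1 inferInstance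

lemma exact_augmentation : Function.Exact (P.complex.d 1 0).hom (augmentation P) :=
  (ShortComplex.ShortExact.moduleCat_exact_iff_function_exact _).1 P.exact₀

lemma augmentation_comp {φ : M ⟶ N} {g : P.complex ⟶ Q.complex}
    (hg : g ≫ Q.π = P.π ≫ (ChainComplex.single₀ _).map φ) :
    augmentation Q ∘ₗ (g.f 0).hom = φ.hom ∘ₗ augmentation P := by
  have h₀ := congr_hom hg 0
  rw [comp_f, comp_f, ChainComplex.single₀_map_f_zero] at h₀
  exact congr_arg ModuleCat.Hom.hom h₀

lemma tor_map_eq_zero (C : Type w) [AddCommGroup C] [Module R C]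
    {φ : M ⟶ N} {g : P.complex ⟶ Q.complex}
    (hg : g ≫ Q.π = P.π ≫ (ChainComplex.single₀ _).map φ) {i : ℕ}
    (h : TensorCyclesToBoundaries C g i) :
    ((Tor (ModuleCat.{w} R) i).obj (ModuleCat.of R C)).map φ = 0 := by
  refine (Functor.leftDerived_map_eq _ i φ g hg).trans ?_
  suffices homologyMap_eq : homologyMap (((MonoidalCategory.tensoringLeft (ModuleCat.{w} R)).obj
      (ModuleCat.of R C)).mapHomologicalComplex _ |>.map g) i = 0 by
    erw [Functor.comp_map, homologyFunctor_map, homologyMap_eq, zero_comp, comp_zero]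
    rfl
  exact homologyMap_eq_zero _ i h

lemma exists_surjective_onto_ker {E₀ E₁ E₂ C : Type*} [AddCommGroup E₀] [Module R E₀]
    [AddCommGroup E₁] [Module R E₁] [AddCommGroup E₂] [Module R E₂] [AddCommGroup C] [Module R C]
    {η : E₀ →ₗ[R] C} {δ₀ : E₁ →ₗ[R] E₀} {δ₁ : E₂ →ₗ[R] E₁} (hδη : Function.Exact δ₀ η)
    (hδ : Function.Exact δ₁ δ₀) :
    ∃ δ : E₁ →ₗ[R] LinearMap.ker η, (LinearMap.ker η).subtype ∘ₗ δ = δ₀ ∧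
      Function.Surjective δ ∧ Function.Exact δ₁ δ :=
  ⟨δ₀.codRestrict _ hδη.apply_apply_eq_zero, rfl,
    fun z => let ⟨w, hw⟩ := (hδη z).1 z.2; ⟨w, Subtype.ext hw⟩,
    fun z => Subtype.ext_iff.trans (hδ z)⟩

section FlatResolution

variable {M N : ModuleCat.{w} R} (φ : M ⟶ N) {C : Type w} [AddCommGroup C] [Module R C]
  {F : ℕ → Type w} [∀ n, AddCommGroup (F n)] [∀ n, Module R (F n)] [∀ n, Module.Flat R (F n)]
  {δ : ∀ n, F (n + 1) →ₗ[R] F n} {η : F 0 →ₗ[R] C}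

omit [∀ n, Module.Flat R (F n)] in
lemma lTensor_rTensor_eq_zero {E E' : Type w} [AddCommGroup E] [Module R E] [AddCommGroup E']
    [Module R E'] {δ : E' →ₗ[R] E} {η : E →ₗ[R] C} (hδη : η ∘ₗ δ = 0) {x : E ⊗[R] M}
    (hx : ∃ y : E' ⊗[R] N, δ.rTensor N y = φ.hom.lTensor E x) :
    φ.hom.lTensor C (η.rTensor M x) = 0 := by
  obtain ⟨y, hy⟩ := hx
  rw [lTensor_rTensor_comm, ← hy, ← LinearMap.rTensor_comp_apply, hδη, LinearMap.rTensor_zero,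
    LinearMap.zero_apply]

lemma tensorCyclesToBoundaries_succ (P : ProjectiveResolution M) (Q : ProjectiveResolution N)
    {g : P.complex ⟶ Q.complex} (hg : g ≫ Q.π = P.π ≫ (ChainComplex.single₀ _).map φ)
    (hη : Function.Surjective η) (hδη : Function.Exact (δ 0) η)
    (hδ : ∀ n, Function.Exact (δ (n + 1)) (δ n))
    (h : ∀ n, ∀ x : F (n + 1) ⊗[R] M, (δ n).rTensor M x = 0 →
      ∃ y : F (n + 2) ⊗[R] N, (δ (n + 1)).rTensor N y = φ.hom.lTensor (F (n + 1)) x) (i : ℕ) :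
    TensorCyclesToBoundaries C g (i + 1) := by
  induction i generalizing F C with
  | zero =>
    obtain ⟨δ', hηδ', hδ', hδδ'⟩ := exists_surjective_onto_ker hδη (hδ 0)
    refine .one g (augmentation_surjective Q) (exact_augmentation P).linearMap_comp_eq_zero
      (exact_augmentation Q) (augmentation_comp P Q hg) η.exact_subtype_ker_map hη
      (exact_projectiveResolution Q 0) fun x hx => ?_
    obtain ⟨x, rfl⟩ := LinearMap.rTensor_surjective M hδ' x
    refine lTensor_rTensor_eq_zero φ hδδ'.linearMap_comp_eq_zero (h 0 x ?_)
    rwa [← LinearMap.rTensor_comp_apply, hηδ'] at hx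
  | succ i ih =>
    obtain ⟨δ', -, hδ', hδδ'⟩ := exists_surjective_onto_ker hδη (hδ 0)
    exact .succ g (flat_projectiveResolution P) (Submodule.injective_subtype _)
      η.exact_subtype_ker_map hη (exact_projectiveResolution Q (i + 1))
      (ih (F := fun n => F (n + 1)) hδ' hδδ' (fun n => hδ (n + 1)) fun n => h (n + 1))

/-- `Tor` is balanced: dimension shifting along the flat resolution `F` of `C` moves a cycle of
`C ⊗ P` to a cycle of `F ⊗ M`. -/
theorem tor_map_eq_zero_of_flatResolution
    (hη : Function.Surjective η) (hδη : Function.Exact (δ 0) η)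
    (hδ : ∀ n, Function.Exact (δ (n + 1)) (δ n))
    (h₀ : ∀ x : F 0 ⊗[R] M, ∃ y : F 1 ⊗[R] N, (δ 0).rTensor N y = φ.hom.lTensor (F 0) x)
    (h : ∀ n, ∀ x : F (n + 1) ⊗[R] M, (δ n).rTensor M x = 0 →
      ∃ y : F (n + 2) ⊗[R] N, (δ (n + 1)).rTensor N y = φ.hom.lTensor (F (n + 1)) x) (i : ℕ) :
    ((Tor (ModuleCat.{w} R) i).obj (ModuleCat.of R C)).map φ = 0 := by
  let P := projectiveResolution M
  let Q := projectiveResolution N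
  have hg := ProjectiveResolution.lift_commutes φ P Q
  refine tor_map_eq_zero P Q C hg ?_
  cases i with
  | zero =>
    refine .zero _ (augmentation_surjective Q) (exact_augmentation Q) (augmentation_comp P Q hg) ?_
    refine LinearMap.ext fun x => ?_
    obtain ⟨x, rfl⟩ := LinearMap.rTensor_surjective M hη x
    exact lTensor_rTensor_eq_zero φ hδη.linearMap_comp_eq_zero (h₀ x)
  | succ i => exact tensorCyclesToBoundaries_succ φ P Q hg hη hδη hδ h i

end FlatResolution
end Tor

section Filtration

variable {T : Type w} [AddCommGroup T] [Module R T]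

/-- The multiplication map `F ⊗ I → T`, whose range is `I • F`. -/
def tensorIdealMap (F : Submodule R T) (I : Ideal R) : F ⊗[R] I →ₗ[R] T :=
  F.subtype ∘ₗ (TensorProduct.rid R F).toLinearMap ∘ₗ I.subtype.lTensor F

@[simp]
lemma tensorIdealMap_tmul (F : Submodule R T) (I : Ideal R) (z : F) (a : I) :
    tensorIdealMap F I (z ⊗ₜ a) = (a : R) • (z : T) := by
  simp [tensorIdealMap]

lemma tensorIdealMap_injective (F : Submodule R T) [Module.Flat R F] (I : Ideal R) :
    Function.Injective (tensorIdealMap F I) :=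
  F.injective_subtype.comp <| (TensorProduct.rid R F).injective.comp <|
    Module.Flat.lTensor_preserves_injective_linearMap _ I.injective_subtype

lemma range_tensorIdealMap (F : Submodule R T) (I : Ideal R) :
    LinearMap.range (tensorIdealMap F I) = I • F := by
  refine le_antisymm ?_ (Submodule.smul_le.2 fun a ha z hz => ⟨⟨z, hz⟩ ⊗ₜ ⟨a, ha⟩, by simp⟩)
  rintro _ ⟨x, rfl⟩
  induction x with
  | zero => simp
  | tmul z a => simpa using Submodule.smul_mem_smul a.2 z.2
  | add x y hx hy => simpa using add_mem hx hy

lemma tensorIdealMap_rTensor {F F' : Submodule R T} {I : Ideal R} {D : T →ₗ[R] T}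
    (hD : ∀ z ∈ F, D z ∈ F') (x : F ⊗[R] I) :
    tensorIdealMap F' I ((D.restrict hD).rTensor I x) = D (tensorIdealMap F I x) := by
  induction x with
  | zero => simp
  | tmul z a => simp
  | add x y hx hy => simp [hx, hy]

lemma tensorIdealMap_lTensor (F : Submodule R T) {I J : Ideal R} (hIJ : I ≤ J) (x : F ⊗[R] I) :
    tensorIdealMap F J ((Submodule.inclusion hIJ).lTensor F x) = tensorIdealMap F I x := by
  induction x with
  | zero => simp
  | tmul z a => simp
  | add x y hx hy => simp [hx, hy]

variable {D : T →ₗ[R] T} {F : ℕ → Submodule R T} [∀ n, Module.Flat R (F n)]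

lemma exists_rTensor_restrict_eq {F F' : Submodule R T} [Module.Flat R F] {I J : Ideal R}
    (hIJ : I ≤ J) (hD : ∀ z ∈ F', D z ∈ F) {x : F ⊗[R] I}
    (h : ∃ w ∈ J • F', D w = tensorIdealMap F I x) :
    ∃ y : F' ⊗[R] J, (D.restrict hD).rTensor J y = (Submodule.inclusion hIJ).lTensor F x := by
  obtain ⟨w, hw, hDw⟩ := h
  obtain ⟨y, rfl⟩ := (range_tensorIdealMap F' J).ge hw
  refine ⟨y, tensorIdealMap_injective F J ?_⟩
  rw [tensorIdealMap_rTensor, hDw, tensorIdealMap_lTensor]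

theorem tor_inclusion_eq_zero {C : Type w} [AddCommGroup C] [Module R C] {η : F 0 →ₗ[R] C}
    (hDF : ∀ n, ∀ z ∈ F (n + 1), D z ∈ F n) (hη : Function.Surjective η)
    (hDη : ∀ z : F 0, η z = 0 ↔ ∃ w ∈ F 1, D w = z)
    (hD : ∀ n, ∀ z ∈ F (n + 1), D z = 0 ↔ ∃ w ∈ F (n + 2), D w = z)
    {I J : Ideal R} (hIJ : I ≤ J) (h₀ : ∀ z ∈ I • F 0, ∃ w ∈ J • F 1, D w = z)
    (h : ∀ n, ∀ z ∈ I • F (n + 1), D z = 0 → ∃ w ∈ J • F (n + 2), D w = z) (i : ℕ) :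
    ((Tor (ModuleCat.{w} R) i).obj (ModuleCat.of R C)).map
      (ModuleCat.ofHom (Submodule.inclusion hIJ)) = 0 := by
  have mem_smul (n : ℕ) (x : F n ⊗[R] I) : tensorIdealMap (F n) I x ∈ I • F n :=
    (range_tensorIdealMap (F n) I).le ⟨x, rfl⟩
  refine tor_map_eq_zero_of_flatResolution (F := fun n => F n) (δ := fun n => D.restrict (hDF n))
    _ hη (fun z => ?_) (fun n z => ?_)
    (fun x => exists_rTensor_restrict_eq hIJ _ (h₀ _ (mem_smul 0 x)))
    (fun n x hx => exists_rTensor_restrict_eq hIJ _ (h n _ (mem_smul _ x) ?_)) i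
  · simp [hDη, Subtype.ext_iff]
  · simp [Subtype.ext_iff, hD n z z.2]
  · rw [← tensorIdealMap_rTensor (hDF n), hx, map_zero]

end Filtration
end Balancing

section Homotopy

lemma list_prod_map_mul_eq_zero {ι A : Type*} [Semiring A] {p : ι → A} {y : A}
    {j : ι} (hcomm : ∀ i, i ≠ j → Commute (p i) y) (hj : p j * y = 0) {l : List ι} (hl : j ∈ l) :
    (l.map p).prod * y = 0 := by
  classical
  induction l with
  | nil => simp at hl
  | cons a l ih =>
    rw [List.map_cons, List.prod_cons, mul_assoc]
    by_cases hjl : j ∈ l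
    · rw [ih hjl, mul_zero]
    · obtain rfl : j = a := (List.mem_cons.1 hl).resolve_right hjl
      have hyl : Commute (l.map p).prod y := Commute.list_prod_left _ _ fun q hq => by
        obtain ⟨i, hi, rfl⟩ := List.mem_map.1 hq
        exact hcomm i fun hij => hjl (hij ▸ hi)
      rw [hyl.eq, ← mul_assoc, hj, zero_mul]

variable {τ k E : Type*} [CommRing k] [AddCommGroup E] [Module k E] {D : Module.End k E}
  {H p : τ → Module.End k E} {U W : Submodule k E}

lemma exists_apply_eq_sub_list_prod (hD : D * D = 0)
    (hH : ∀ j, D * H j + H j * D = 1 - p j) (hpU : ∀ j, ∀ z ∈ U, p j z ∈ U)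
    (hHW : ∀ j, ∀ z ∈ U, H j z ∈ W) (l : List τ) {z : E} (hz : z ∈ U) (hDz : D z = 0) :
    (l.map p).prod z ∈ U ∧ D ((l.map p).prod z) = 0 ∧ ∃ w ∈ W, D w = z - (l.map p).prod z := by
  have hDD (y : E) : D (D y) = 0 := LinearMap.congr_fun hD y
  induction l with
  | nil => exact ⟨hz, hDz, 0, zero_mem W, by simp⟩
  | cons j l ih =>
    obtain ⟨hU, hD₀, w, hw, hDw⟩ := ih
    set y := (l.map p).prod z
    have hDH : D (H j y) = y - p j y := by simpa [hD₀] using LinearMap.congr_fun (hH j) y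
    simp only [List.map_cons, List.prod_cons, Module.End.mul_apply]
    refine ⟨hpU j y hU, ?_, w + H j y, add_mem hw (hHW j y hU), ?_⟩
    · rw [← sub_sub_cancel y (p j y), ← hDH, map_sub, hDD, hD₀, sub_zero]
    · rw [map_add, hDw, hDH, sub_add_sub_cancel]

end Homotopy

section Anticommutation

/-- The relations between contraction with and exterior multiplication by the vectors of a basis:
`c i` annihilates and `w i` creates the `i`-th basis vector. -/
structure AnticommutationRelations {σ k Λ : Type*} [CommRing k] [AddCommGroup Λ] [Module k Λ]
    (c w : σ → Module.End k Λ) : Prop where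
  annihilator_sq (i : σ) : c i * c i = 0
  annihilator_add_swap (i j : σ) : c i * c j + c j * c i = 0
  creator_sq (i : σ) : w i * w i = 0
  creator_add_swap (i j : σ) : w i * w j + w j * w i = 0
  annihilator_creator (i : σ) : c i * w i + w i * c i = 1
  annihilator_creator_of_ne {i j : σ} (hij : i ≠ j) : c i * w j + w j * c i = 0

variable {σ k Λ : Type*} [CommRing k] [AddCommGroup Λ] [Module k Λ]
  {c w : σ → Module.End k Λ}

lemma AnticommutationRelations.annihilator_mul_creator_mul_creator
    (h : AnticommutationRelations c w) (j : σ) : c j * w j * w j = 0 := by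
  rw [mul_assoc, h.creator_sq, mul_zero]

lemma AnticommutationRelations.commute_annihilator_mul_creator (h : AnticommutationRelations c w)
    {i j : σ} (hij : i ≠ j) : Commute (c i * w i) (w j) := by
  rw [commute_iff_eq, mul_assoc, eq_neg_of_add_eq_zero_left (h.creator_add_swap i j), mul_neg,
    ← mul_assoc, eq_neg_of_add_eq_zero_left (h.annihilator_creator_of_ne hij), neg_mul, neg_neg,
    mul_assoc]

end Anticommutation

section Koszul

/-- `q j` divides by `x j`: it is a `k`-linear left inverse of multiplication by `x j` and commutes
with multiplication by the other `x i`. -/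
structure IsDivision {σ k R : Type*} [CommRing k] [CommRing R] [Algebra k R] (x : σ → R)
    (q : σ → Module.End k R) : Prop where
  mul_self (j : σ) (r : R) : q j (x j * r) = r
  mul_of_ne {i j : σ} (hij : i ≠ j) (r : R) : q j (x i * r) = x i * q j r

variable {σ k R Λ : Type*} [CommRing k] [CommRing R] [Algebra k R] [AddCommGroup Λ] [Module k Λ]

/-- The projection `1 - x j * q j` onto the remainders of division by `x j`. -/
def remainder (x : σ → R) (q : σ → Module.End k R) (j : σ) : Module.End k R :=
  1 - LinearMap.mulLeft k (x j) * q j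

section Division

variable {x : σ → R} {q : σ → Module.End k R}

lemma IsDivision.mul_mulLeft_self (h : IsDivision x q) (j : σ) :
    q j * LinearMap.mulLeft k (x j) = 1 :=
  LinearMap.ext (h.mul_self j)

lemma IsDivision.commute_mulLeft (h : IsDivision x q) {i j : σ} (hij : i ≠ j) :
    Commute (q j) (LinearMap.mulLeft k (x i)) :=
  LinearMap.ext (h.mul_of_ne hij)

lemma commute_mulLeft_mulLeft (a b : R) :
    Commute (LinearMap.mulLeft k a) (LinearMap.mulLeft k b) :=
  LinearMap.ext fun r => mul_left_comm a b r

lemma IsDivision.remainder_mul_mulLeft_self (h : IsDivision x q) (j : σ) :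
    remainder x q j * LinearMap.mulLeft k (x j) = 0 := by
  rw [remainder, sub_mul, mul_assoc, h.mul_mulLeft_self, one_mul, mul_one, sub_self]

lemma IsDivision.commute_remainder_mulLeft (h : IsDivision x q) {i j : σ} (hij : i ≠ j) :
    Commute (remainder x q i) (LinearMap.mulLeft k (x j)) :=
  (Commute.one_left _).sub_left
    ((commute_mulLeft_mulLeft (x i) (x j)).mul_left (h.commute_mulLeft hij.symm))

end Division

variable (x : σ → R) (q : σ → Module.End k R) (c w : σ → Module.End k Λ)

/-- The Koszul differential `∑ᵢ xᵢ ⊗ cᵢ`. -/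
def koszulDifferential [Fintype σ] : R ⊗[k] Λ →ₗ[R] R ⊗[k] Λ :=
  ∑ i, x i • (c i).baseChange R

/-- Division by `x j` combined with creation of the `j`-th basis vector, a contracting homotopy of
the Koszul complex away from `x j`. -/
def koszulHomotopy (j : σ) : Module.End k (R ⊗[k] Λ) :=
  TensorProduct.map (q j) (w j)

/-- The projection onto the part of the Koszul complex which involves neither `x j` nor the
`j`-th basis vector. -/
def koszulProjection (j : σ) : Module.End k (R ⊗[k] Λ) :=
  TensorProduct.map (remainder x q j) (c j * w j)

variable {x q c w}

lemma restrictScalars_koszulDifferential [Fintype σ] :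
    (koszulDifferential x c).restrictScalars k =
      ∑ i, TensorProduct.map (LinearMap.mulLeft k (x i)) (c i) := by
  ext r y
  simp [koszulDifferential, TensorProduct.smul_tmul']

lemma koszulDifferential_mul_self [Fintype σ] (h : AnticommutationRelations c w) :
    ((koszulDifferential x c).restrictScalars k : Module.End k (R ⊗[k] Λ)) *
      (koszulDifferential x c).restrictScalars k = 0 := by
  classical
  rw [restrictScalars_koszulDifferential, Finset.sum_mul_sum, ← Finset.sum_product']
  refine Finset.sum_involution (fun ij _ => ij.swap) (fun ij _ => ?_) (fun ij _ hne heq => hne ?_)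
    (fun _ _ => Finset.mem_univ _) fun _ _ => Prod.swap_swap _
  · rw [← TensorProduct.map_mul, ← TensorProduct.map_mul, Prod.fst_swap, Prod.snd_swap,
      (commute_mulLeft_mulLeft (x ij.2) (x ij.1)).eq, ← TensorProduct.map_add_right,
      h.annihilator_add_swap, TensorProduct.map_zero_right]
  · rw [← TensorProduct.map_mul, show ij.2 = ij.1 from congr_arg Prod.fst heq, h.annihilator_sq,
      TensorProduct.map_zero_right]

lemma koszulDifferential_mul_koszulHomotopy_add [Fintype σ] (hq : IsDivision x q)
    (h : AnticommutationRelations c w) (j : σ) :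
    (koszulDifferential x c).restrictScalars k * koszulHomotopy q w j +
      koszulHomotopy q w j * (koszulDifferential x c).restrictScalars k =
        1 - koszulProjection x q c w j := by
  rw [restrictScalars_koszulDifferential, koszulHomotopy, Finset.sum_mul, Finset.mul_sum,
    ← Finset.sum_add_distrib, Fintype.sum_eq_single j fun i hij => ?_]
  · refine eq_sub_of_add_eq (G := Module.End k (R ⊗[k] Λ)) ?_
    rw [← TensorProduct.map_mul, ← TensorProduct.map_mul, hq.mul_mulLeft_self, koszulProjection,
      add_right_comm, ← TensorProduct.map_add_left, remainder, add_sub_cancel,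
      ← TensorProduct.map_add_right, h.annihilator_creator, TensorProduct.map_one]
  · rw [← TensorProduct.map_mul, ← TensorProduct.map_mul, (hq.commute_mulLeft hij).eq,
      ← TensorProduct.map_add_right, h.annihilator_creator_of_ne hij, TensorProduct.map_zero_right]

lemma list_prod_koszulProjection_mul_mulLeft (hq : IsDivision x q) {l : List σ} {j : σ}
    (hj : j ∈ l) :
    (l.map (koszulProjection x q c w)).prod * TensorProduct.map (LinearMap.mulLeft k (x j)) 1 = 0 :=
  list_prod_map_mul_eq_zero (fun i hij => by
    rw [commute_iff_eq, koszulProjection, ← TensorProduct.map_mul, ← TensorProduct.map_mul,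
      (hq.commute_remainder_mulLeft hij).eq, one_mul, mul_one]) (by
    rw [koszulProjection, ← TensorProduct.map_mul, hq.remainder_mul_mulLeft_self,
      TensorProduct.map_zero_left]) hj

lemma list_prod_koszulProjection_mul_creator (h : AnticommutationRelations c w)
    {l : List σ} {j : σ} (hj : j ∈ l) :
    (l.map (koszulProjection x q c w)).prod * TensorProduct.map 1 (w j) = 0 :=
  list_prod_map_mul_eq_zero (fun i hij => by
    rw [commute_iff_eq, koszulProjection, ← TensorProduct.map_mul, ← TensorProduct.map_mul,
      (h.commute_annihilator_mul_creator hij).eq, one_mul, mul_one]) (by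
    rw [koszulProjection, ← TensorProduct.map_mul, h.annihilator_mul_creator_mul_creator,
      TensorProduct.map_zero_right]) hj

end Koszul

section ExteriorAlgebra

open ExteriorAlgebra

variable (k : Type*) {σ : Type*} [CommRing k]

/-- Contraction of the exterior algebra of `k^σ` with the `i`-th coordinate form. -/
def contract (i : σ) : Module.End k (ExteriorAlgebra k (σ → k)) :=
  CliffordAlgebra.contractLeft (LinearMap.proj i)

variable {k}

lemma contract_ι_mul (i : σ) (v : σ → k) (y : ExteriorAlgebra k (σ → k)) :
    contract k i (ι k v * y) =
      v i • y - ι k v * contract k i y :=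
  CliffordAlgebra.contractLeft_ι_mul _ v y

variable {n : ℕ} {y : ExteriorAlgebra k (σ → k)}

lemma one_mem_exteriorPower_zero : (1 : ExteriorAlgebra k (σ → k)) ∈ ⋀[k]^0 (σ → k) := by
  rw [exteriorPower, pow_zero]
  exact Submodule.one_le.1 le_rfl

lemma contract_exteriorPower_zero (i : σ) (hy : y ∈ ⋀[k]^0 (σ → k)) : contract k i y = 0 := by
  rw [exteriorPower, pow_zero] at hy
  obtain ⟨r, rfl⟩ := Submodule.mem_one.1 hy
  rw [contract, CliffordAlgebra.contractLeft_algebraMap]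

lemma contract_mem_exteriorPower (i : σ) :
    ∀ {n : ℕ} {y : ExteriorAlgebra k (σ → k)}, y ∈ ⋀[k]^(n + 1) (σ → k) →
      contract k i y ∈ ⋀[k]^n (σ → k)
  | n, y, hy => by
    rw [exteriorPower, pow_succ'] at hy
    induction hy using Submodule.mul_induction_on' with
    | add x _ y _ hx hy => simpa only [map_add] using add_mem hx hy
    | mem_mul_mem x hx y hy =>
      obtain ⟨v, rfl⟩ := hx
      rw [contract_ι_mul]
      refine sub_mem (Submodule.smul_mem _ _ hy) ?_
      match n with
      | 0 => rw [contract_exteriorPower_zero i hy, mul_zero]; exact zero_mem _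
      | n + 1 =>
        rw [exteriorPower, pow_succ']
        exact Submodule.mul_mem_mul ⟨v, rfl⟩ (contract_mem_exteriorPower i hy)

variable (k) [DecidableEq σ]

/-- Left exterior multiplication by the `j`-th standard basis vector of `k^σ`. -/
def wedge (j : σ) : Module.End k (ExteriorAlgebra k (σ → k)) :=
  LinearMap.mulLeft k (ι k (Pi.single j 1))

lemma anticommutationRelations_contract_wedge :
    AnticommutationRelations (contract k (σ := σ)) (wedge k) where
  annihilator_sq i := LinearMap.ext fun y => CliffordAlgebra.contractLeft_contractLeft _ y
  annihilator_add_swap i j := LinearMap.ext fun y =>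
    add_eq_zero_iff_eq_neg.2 (CliffordAlgebra.contractLeft_comm _ _ y)
  creator_sq i := LinearMap.ext fun y => by simp [wedge, ← mul_assoc]
  creator_add_swap i j := LinearMap.ext fun y => by
    simp only [wedge, Module.End.mul_apply, LinearMap.add_apply, LinearMap.mulLeft_apply,
      ← mul_assoc, ← add_mul, LinearMap.zero_apply]
    rw [ι_add_mul_swap, zero_mul]
  annihilator_creator i := LinearMap.ext fun y =>
    add_eq_of_eq_sub <| (contract_ι_mul i _ y).trans (by simp [wedge])
  annihilator_creator_of_ne {i j} hij := LinearMap.ext fun y =>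
    add_eq_of_eq_sub <| (contract_ι_mul i _ y).trans (by simp [wedge, hij])

variable {k}

lemma wedge_mem_exteriorPower (j : σ) (hy : y ∈ ⋀[k]^n (σ → k)) :
    wedge k j y ∈ ⋀[k]^(n + 1) (σ → k) := by
  rw [exteriorPower, pow_succ']
  exact Submodule.mul_mem_mul ⟨_, rfl⟩ hy

lemma exteriorPower_succ_le [Finite σ] (n : ℕ) :
    ⋀[k]^(n + 1) (σ → k) ≤ ⨆ j, (⋀[k]^n (σ → k)).map (wedge k j) := by
  cases nonempty_fintype σ
  rw [exteriorPower, pow_succ', Submodule.mul_le]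
  rintro _ ⟨v, rfl⟩ y hy
  have hv : v = ∑ j, v j • Pi.single j 1 := by
    simp [← Pi.single_smul, Finset.univ_sum_single v]
  rw [hv, map_sum, Finset.sum_mul]
  refine Submodule.sum_mem_iSup fun j => ?_
  rw [map_smul, smul_mul_assoc]
  exact Submodule.smul_mem _ _ ⟨y, hy, rfl⟩

end ExteriorAlgebra

section IdealSmulBaseChange

variable {k R Λ : Type*} [CommRing k] [CommRing R] [Algebra k R] [AddCommGroup Λ] [Module k Λ]
  {I J : Ideal R} {N N' : Submodule k Λ}

lemma tmul_mem_smul_baseChange {r : R} (hr : r ∈ I) {y : Λ} (hy : y ∈ N) :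
    r ⊗ₜ y ∈ I • N.baseChange R := by
  rw [← mul_one r, ← smul_eq_mul, ← TensorProduct.smul_tmul']
  exact Submodule.smul_mem_smul hr (Submodule.tmul_mem_baseChange_of_mem 1 hy)

lemma smul_mem_of_mem_baseChange {S : Submodule k (R ⊗[k] Λ)}
    (hS : ∀ r ∈ I, ∀ y ∈ N, r ⊗ₜ y ∈ S) {r : R} (hr : r ∈ I) {z : R ⊗[k] Λ}
    (hz : z ∈ N.baseChange R) : r • z ∈ S := by
  rw [Submodule.baseChange_eq_span] at hz
  induction hz using Submodule.span_induction generalizing r with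
  | zero => rw [smul_zero]; exact zero_mem _
  | add z z' _ _ hz hz' => rw [smul_add]; exact add_mem (hz hr) (hz' hr)
  | smul a z _ hz => rw [smul_smul]; exact hz (I.mul_mem_right a hr)
  | mem z hz =>
    obtain ⟨y, hy, rfl⟩ := hz
    rw [TensorProduct.mk_apply, TensorProduct.smul_tmul', smul_eq_mul, mul_one]
    exact hS r hr y hy

lemma mem_of_mem_smul_baseChange {S : Submodule k (R ⊗[k] Λ)}
    (hS : ∀ r ∈ I, ∀ y ∈ N, r ⊗ₜ y ∈ S) {z : R ⊗[k] Λ} (hz : z ∈ I • N.baseChange R) :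
    z ∈ S := by
  induction hz using Submodule.smul_induction_on' with
  | smul r hr z hz => exact smul_mem_of_mem_baseChange hS hr hz
  | add _ _ _ _ h h' => exact add_mem h h'

lemma map_mem_smul_baseChange {f : Module.End k R} {g : Module.End k Λ} (hf : ∀ r ∈ I, f r ∈ J)
    (hg : ∀ y ∈ N, g y ∈ N') {z : R ⊗[k] Λ} (hz : z ∈ I • N.baseChange R) :
    TensorProduct.map f g z ∈ J • N'.baseChange R :=
  mem_of_mem_smul_baseChange
    (S := ((J • N'.baseChange R).restrictScalars k).comap (TensorProduct.map f g))
    (fun r hr y hy => tmul_mem_smul_baseChange (hf r hr) (hg y hy)) hz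

lemma baseChange_mem_baseChange {g : Module.End k Λ} (hg : ∀ y ∈ N, g y ∈ N') {z : R ⊗[k] Λ}
    (hz : z ∈ N.baseChange R) : g.baseChange R z ∈ N'.baseChange R := by
  rw [← Submodule.top_smul (N.baseChange R)] at hz
  rw [← Submodule.top_smul (N'.baseChange R)]
  exact map_mem_smul_baseChange (f := LinearMap.id) (fun _ hr => hr) hg hz

end IdealSmulBaseChange

section KoszulComplex

open ExteriorAlgebra

variable {k R σ : Type*} [CommRing k] [CommRing R] [Algebra k R]

variable (k R σ) in
/-- The term of degree `n` of the Koszul complex, inside its total module. -/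
def koszulTerm (n : ℕ) : Submodule R (R ⊗[k] ExteriorAlgebra k (σ → k)) :=
  (⋀[k]^n (σ → k)).baseChange R

instance flat_koszulTerm [Finite σ] [Module.Flat k R] (n : ℕ) :
    Module.Flat R (koszulTerm k R σ n) :=
  .of_linearEquiv (Submodule.toBaseChange.toLinearEquiv R (⋀[k]^n (σ → k))).symm

variable [Fintype σ] {x : σ → R} {n : ℕ} {I J : Ideal R} {z : R ⊗[k] ExteriorAlgebra k (σ → k)}

lemma koszulDifferential_mem (hz : z ∈ koszulTerm k R σ (n + 1)) :
    koszulDifferential x (contract k) z ∈ koszulTerm k R σ n := by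
  rw [koszulDifferential, LinearMap.sum_apply]
  refine sum_mem fun i _ => Submodule.smul_mem _ _ ?_
  exact baseChange_mem_baseChange (fun y hy => contract_mem_exteriorPower i hy) hz

variable {q : σ → Module.End k R}

lemma koszulDifferential_koszulDifferential (z : R ⊗[k] ExteriorAlgebra k (σ → k)) :
    koszulDifferential x (contract k) (koszulDifferential x (contract k) z) = 0 := by
  classical
  exact LinearMap.congr_fun
    (koszulDifferential_mul_self (anticommutationRelations_contract_wedge k)) z

lemma exists_koszulDifferential_eq [DecidableEq σ] (hq : IsDivision x q)
    (hI : ∀ j, ∀ r ∈ I, x j * q j r ∈ I) (hIJ : ∀ j, ∀ r ∈ I, q j r ∈ J)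
    (hz : z ∈ I • koszulTerm k R σ n)
    (hdz : koszulDifferential x (contract k) z = 0)
    (hprod : (Finset.univ.toList.map (koszulProjection x q (contract k) (wedge k))).prod z = 0) :
    ∃ w ∈ J • koszulTerm k R σ (n + 1), koszulDifferential x (contract k) w = z := by
  have hcar := anticommutationRelations_contract_wedge k (σ := σ)
  obtain ⟨-, -, w, hw, hdw⟩ := exists_apply_eq_sub_list_prod
    (U := (I • koszulTerm k R σ n).restrictScalars k)
    (W := (J • koszulTerm k R σ (n + 1)).restrictScalars k)
    (koszulDifferential_mul_self hcar) (koszulDifferential_mul_koszulHomotopy_add hq hcar)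
    (fun j z hz => map_mem_smul_baseChange (fun r hr => sub_mem hr (hI j r hr))
      (fun y hy => contract_mem_exteriorPower j (wedge_mem_exteriorPower j hy)) hz)
    (fun j z hz => map_mem_smul_baseChange (hIJ j) (fun y => wedge_mem_exteriorPower j) hz)
    Finset.univ.toList hz hdz
  exact ⟨w, hw, by rw [← sub_zero z, ← hprod]; exact hdw⟩

lemma exists_koszulDifferential_eq_of_le_span (hq : IsDivision x q)
    (hIx : I ≤ Ideal.span (Set.range x)) (hI : ∀ j, ∀ r ∈ I, x j * q j r ∈ I)
    (hIJ : ∀ j, ∀ r ∈ I, q j r ∈ J) (hz : z ∈ I • koszulTerm k R σ n)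
    (hdz : koszulDifferential x (contract k) z = 0) :
    ∃ w ∈ J • koszulTerm k R σ (n + 1), koszulDifferential x (contract k) w = z := by
  classical
  refine exists_koszulDifferential_eq hq hI hIJ hz hdz
    (mem_of_mem_smul_baseChange (S := LinearMap.ker _) (fun r hr y _ => ?_) hz)
  obtain ⟨a, rfl⟩ := Ideal.mem_span_range_iff_exists_fun.1 (hIx hr)
  rw [LinearMap.mem_ker, TensorProduct.sum_tmul, map_sum]
  refine Finset.sum_eq_zero fun j _ => ?_
  rw [mul_comm]
  exact LinearMap.congr_fun (list_prod_koszulProjection_mul_mulLeft hq (Finset.mem_toList.2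
    (Finset.mem_univ j))) (a j ⊗ₜ y)

lemma koszulDifferential_eq_zero_iff (hq : IsDivision x q) (hz : z ∈ koszulTerm k R σ (n + 1)) :
    koszulDifferential x (contract k) z = 0 ↔
      ∃ w ∈ koszulTerm k R σ (n + 2), koszulDifferential x (contract k) w = z := by
  classical
  refine ⟨fun hdz => ?_, ?_⟩
  · rw [← Submodule.top_smul (koszulTerm k R σ (n + 1))] at hz
    rw [← Submodule.top_smul (koszulTerm k R σ (n + 2))]
    refine exists_koszulDifferential_eq hq (fun _ _ _ => Submodule.mem_top)
      (fun _ _ _ => Submodule.mem_top) hz hdz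
      (mem_of_mem_smul_baseChange (S := LinearMap.ker _) (fun r _ y hy => ?_) hz)
    set Φ := (Finset.univ.toList.map (koszulProjection x q (contract k) (wedge k))).prod
    have hle : ⋀[k]^(n + 1) (σ → k) ≤ LinearMap.ker (Φ ∘ₗ TensorProduct.mk k R _ r) :=
      (exteriorPower_succ_le n).trans <| iSup_le fun j => Submodule.map_le_iff_le_comap.2
        fun y _ => LinearMap.congr_fun (list_prod_koszulProjection_mul_creator
          (anticommutationRelations_contract_wedge k) (Finset.mem_toList.2 (Finset.mem_univ j)))
          (r ⊗ₜ y)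
    exact hle hy
  · rintro ⟨w, -, rfl⟩
    exact koszulDifferential_koszulDifferential w

end KoszulComplex

section KoszulAugmentation

open ExteriorAlgebra

variable {k R σ : Type*} [CommRing k] [CommRing R] [Algebra k R]
  {z : R ⊗[k] ExteriorAlgebra k (σ → k)}

variable (k R σ) in
/-- The retraction of the total module of the Koszul complex onto its term of degree `0`, which is
identified with `R`. -/
def koszulDegreeZero : R ⊗[k] ExteriorAlgebra k (σ → k) →ₗ[R] R :=
  (AlgebraTensorModule.rid k R R).toLinearMap ∘ₗ
    (algebraMapInv (R := k) (M := σ → k)).toLinearMap.baseChange R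

lemma koszulDegreeZero_tmul_one (r : R) : koszulDegreeZero k R σ (r ⊗ₜ 1) = r := by
  simp [koszulDegreeZero]

lemma koszulDegreeZero_tmul_eq_self (hz : z ∈ koszulTerm k R σ 0) :
    koszulDegreeZero k R σ z ⊗ₜ 1 = z := by
  have hS : z ∈ LinearMap.ker (((TensorProduct.mk k R _).flip 1 ∘ₗ
      (koszulDegreeZero k R σ).restrictScalars k : Module.End k _) - 1) := by
    rw [koszulTerm, ← Submodule.top_smul (Submodule.baseChange R _)] at hz
    refine mem_of_mem_smul_baseChange (fun r _ y hy => ?_) hz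
    rw [exteriorPower, pow_zero] at hy
    obtain ⟨c, rfl⟩ := Submodule.mem_one.1 hy
    simp [koszulDegreeZero, Algebra.algebraMap_eq_smul_one]
  exact sub_eq_zero.1 hS

variable [Fintype σ] {x : σ → R}

lemma koszulDegreeZero_koszulDifferential_mem (z : R ⊗[k] ExteriorAlgebra k (σ → k)) :
    koszulDegreeZero k R σ (koszulDifferential x (contract k) z) ∈ Ideal.span (Set.range x) := by
  simp only [koszulDifferential, LinearMap.sum_apply, LinearMap.smul_apply, map_sum, map_smul]
  exact sum_mem fun i _ => Ideal.mul_mem_right _ _ (Ideal.subset_span ⟨i, rfl⟩)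

lemma koszulDifferential_eq_zero_of_mem_koszulTerm_zero (hz : z ∈ koszulTerm k R σ 0) :
    koszulDifferential x (contract k) z = 0 := by
  have h₁ (i : σ) : contract k i 1 = 0 := contract_exteriorPower_zero i one_mem_exteriorPower_zero
  rw [← koszulDegreeZero_tmul_eq_self hz]
  simp [koszulDifferential, h₁]

variable (k x) in
/-- The augmentation of the Koszul complex of `x`, which makes it a resolution of `R ⧸ (x)`. -/
def koszulAugmentation : koszulTerm k R σ 0 →ₗ[R] R ⧸ Ideal.span (Set.range x) :=
  (Ideal.span (Set.range x)).mkQ ∘ₗ koszulDegreeZero k R σ ∘ₗ (koszulTerm k R σ 0).subtype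

omit [Fintype σ] in
lemma koszulAugmentation_surjective : Function.Surjective (koszulAugmentation k x) := by
  intro r
  obtain ⟨r, rfl⟩ := Submodule.mkQ_surjective _ r
  refine ⟨⟨r ⊗ₜ 1, Submodule.tmul_mem_baseChange_of_mem r one_mem_exteriorPower_zero⟩, ?_⟩
  simp [koszulAugmentation, koszulDegreeZero_tmul_one]

omit [Fintype σ] in
lemma koszulAugmentation_eq_zero_iff (z : koszulTerm k R σ 0) :
    koszulAugmentation k x z = 0 ↔
      koszulDegreeZero k R σ z ∈ Ideal.span (Set.range x) :=
  Submodule.Quotient.mk_eq_zero _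

variable {q : σ → Module.End k R}

lemma koszulAugmentation_eq_zero_iff_exists (hq : IsDivision x q) (z : koszulTerm k R σ 0) :
    koszulAugmentation k x z = 0 ↔
      ∃ w ∈ koszulTerm k R σ 1, koszulDifferential x (contract k) w = z := by
  rw [koszulAugmentation_eq_zero_iff]
  refine ⟨fun hz => ?_, ?_⟩
  · have hz' : (z : R ⊗[k] ExteriorAlgebra k (σ → k)) ∈
        Ideal.span (Set.range x) • koszulTerm k R σ 0 := by
      rw [← koszulDegreeZero_tmul_eq_self z.2]
      exact tmul_mem_smul_baseChange hz one_mem_exteriorPower_zero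
    rw [← Submodule.top_smul (koszulTerm k R σ 1)]
    exact exists_koszulDifferential_eq_of_le_span hq le_rfl
      (fun j r _ => Ideal.mul_mem_right _ _ (Ideal.subset_span ⟨j, rfl⟩))
      (fun _ _ _ => Submodule.mem_top) hz' (koszulDifferential_eq_zero_of_mem_koszulTerm_zero z.2)
  · rintro ⟨w, -, hw⟩
    rw [← hw]
    exact koszulDegreeZero_koszulDifferential_mem w

end KoszulAugmentation

section KoszulTor

variable {k : Type u} {σ : Type v} {R : Type (max u v w)} [CommRing k] [CommRing R] [Algebra k R]
  [Module.Flat k R] [Finite σ] {x : σ → R} {q : σ → Module.End k R} {I J : Ideal R}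

theorem tor_inclusion_eq_zero_of_isDivision (hq : IsDivision x q) (hIJ : I ≤ J)
    (hIx : I ≤ Ideal.span (Set.range x)) (hI : ∀ j, ∀ r ∈ I, x j * q j r ∈ I)
    (hqIJ : ∀ j, ∀ r ∈ I, q j r ∈ J) (i : ℕ) :
    ((Tor (ModuleCat.{max u v w} R) i).obj (ModuleCat.of R (R ⧸ Ideal.span (Set.range x)))).map
      (ModuleCat.ofHom (Submodule.inclusion hIJ)) = 0 := by
  cases nonempty_fintype σ
  exact tor_inclusion_eq_zero (F := koszulTerm k R σ) (D := koszulDifferential x (contract k))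
    (fun _ _ hz => koszulDifferential_mem hz) koszulAugmentation_surjective
    (koszulAugmentation_eq_zero_iff_exists hq) (fun _ _ hz => koszulDifferential_eq_zero_iff hq hz)
    hIJ
    (fun _ hz => exists_koszulDifferential_eq_of_le_span hq hIx hI hqIJ hz
      (koszulDifferential_eq_zero_of_mem_koszulTerm_zero (Submodule.smul_le_right hz)))
    (fun _ _ hz hdz => exists_koszulDifferential_eq_of_le_span hq hIx hI hqIJ hz hdz) i

end KoszulTor

lemma mem_of_mem_span_mul {k R : Type*} [CommRing k] [CommRing R] [Algebra k R] {S : Set R}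
    {T : Ideal R} {P : Submodule k R} (hP : ∀ a ∈ S, ∀ p ∈ T, a * p ∈ P) {r : R}
    (hr : r ∈ Ideal.span S * T) : r ∈ P := by
  induction hr using Submodule.mul_induction_on' with
  | add _ _ _ _ h h' => exact add_mem h h'
  | mem_mul_mem a ha p hp =>
    induction ha using Submodule.span_induction generalizing p with
    | mem a ha => exact hP a ha p hp
    | zero => rw [zero_mul]; exact zero_mem P
    | add a b _ _ ha hb => rw [add_mul]; exact add_mem (ha p hp) (hb p hp)
    | smul c a _ ha =>
      rw [smul_eq_mul, mul_comm c, mul_assoc]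
      exact ha _ (T.mul_mem_left c hp)

section Monomial

open MvPolynomial

variable {σ k : Type*} [CommRing k]

variable (k) in
/-- Division by the variable `X j`: the coefficient of `a` in `divX k j p` is that of
`single j 1 + a` in `p`. -/
def divX (j : σ) : Module.End k (MvPolynomial σ k) where
  toFun p := p.divMonomial (Finsupp.single j 1)
  map_add' p p' := add_divMonomial p p' _
  map_smul' r p := by ext; simp [coeff_divMonomial]

lemma divX_X_mul (j : σ) (p : MvPolynomial σ k) : divX k j (X j * p) = p :=
  X_mul_divMonomial j p

lemma divX_monomial_mul_of_eq_zero {j : σ} {a : σ →₀ ℕ} (ha : a j = 0) (p : MvPolynomial σ k) :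
    divX k j (monomial a 1 * p) = monomial a 1 * divX k j p := by
  ext b
  have hab : a ≤ Finsupp.single j 1 + b ↔ a ≤ b := by
    classical
    refine forall_congr' fun i => ?_
    obtain rfl | hij := eq_or_ne i j
    · simp [ha]
    · simp [hij.symm]
  have hsub : a ≤ b → Finsupp.single j 1 + b - a = Finsupp.single j 1 + (b - a) :=
    fun h => add_tsub_assoc_of_le h _
  simp +contextual [divX, coeff_divMonomial, coeff_monomial_mul', hab, hsub]

lemma isDivision_divX : IsDivision (X : σ → MvPolynomial σ k) (divX k) where
  mul_self := divX_X_mul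
  mul_of_ne hij p := divX_monomial_mul_of_eq_zero (Finsupp.single_eq_of_ne hij.symm) p

lemma X_mul_monomial_tsub {j : σ} {a : σ →₀ ℕ} (ha : a j ≠ 0) :
    X j * monomial (a - Finsupp.single j 1) (1 : k) = monomial a 1 := by
  rw [MvPolynomial.X, monomial_mul, mul_one,
    add_tsub_cancel_of_le (Finsupp.single_le_iff.2 (Nat.one_le_iff_ne_zero.2 ha))]

lemma divX_monomial_mul_of_ne_zero {j : σ} {a : σ →₀ ℕ} (ha : a j ≠ 0) (p : MvPolynomial σ k) :
    divX k j (monomial a 1 * p) = monomial (a - Finsupp.single j 1) 1 * p := by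
  rw [← X_mul_monomial_tsub ha, mul_assoc, divX_X_mul]

variable {A : Set (σ →₀ ℕ)}

variable (k A) in
/-- The ideal generated by the monomials with exponents in `A`. -/
def monomialIdeal : Ideal (MvPolynomial σ k) :=
  Ideal.span ((fun a => monomial a 1) '' A)

lemma monomial_mem_monomialIdeal {a : σ →₀ ℕ} (ha : a ∈ A) :
    monomial a 1 ∈ monomialIdeal k A :=
  Ideal.subset_span ⟨a, ha, rfl⟩

lemma mem_of_mem_monomialIdeal_mul {T : Ideal (MvPolynomial σ k)}
    {P : Submodule k (MvPolynomial σ k)} (hP : ∀ a ∈ A, ∀ p ∈ T, monomial a 1 * p ∈ P)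
    {p : MvPolynomial σ k} (hp : p ∈ monomialIdeal k A * T) : p ∈ P :=
  mem_of_mem_span_mul (Set.forall_mem_image.2 hP) hp

lemma X_mul_divX_mem_monomialIdeal_mul {j : σ} {T : Ideal (MvPolynomial σ k)}
    (hT : ∀ p ∈ T, X j * divX k j p ∈ T) {p : MvPolynomial σ k} (hp : p ∈ monomialIdeal k A * T) :
    X j * divX k j p ∈ monomialIdeal k A * T := by
  refine mem_of_mem_monomialIdeal_mul (P := ((monomialIdeal k A * T).restrictScalars k).comap
    (LinearMap.mulLeft k (X j) ∘ₗ divX k j)) (fun a ha p hp => ?_) hp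
  change X j * divX k j (monomial a 1 * p) ∈ monomialIdeal k A * T
  by_cases haj : a j = 0
  · rw [divX_monomial_mul_of_eq_zero haj, mul_left_comm]
    exact Ideal.mul_mem_mul (monomial_mem_monomialIdeal ha) (hT p hp)
  · rw [divX_monomial_mul_of_ne_zero haj, ← mul_assoc, X_mul_monomial_tsub haj]
    exact Ideal.mul_mem_mul (monomial_mem_monomialIdeal ha) hp

lemma X_mul_divX_mem_monomialIdeal_pow (j : σ) (s : ℕ) :
    ∀ p ∈ monomialIdeal k A ^ s, X j * divX k j p ∈ monomialIdeal k A ^ s := by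
  induction s with
  | zero => simp
  | succ s ih =>
    rw [pow_succ']
    exact fun p => X_mul_divX_mem_monomialIdeal_mul ih

lemma divX_mem_monomialIdeal_pow (j : σ) (s : ℕ) :
    ∀ p ∈ monomialIdeal k A ^ (s + 1), divX k j p ∈ monomialIdeal k A ^ s := by
  induction s with
  | zero => simp
  | succ s ih =>
    intro p hp
    rw [pow_succ'] at hp
    refine mem_of_mem_monomialIdeal_mul
      (P := ((monomialIdeal k A ^ (s + 1)).restrictScalars k).comap (divX k j))
      (fun a ha p hp => ?_) hp
    change divX k j (monomial a 1 * p) ∈ monomialIdeal k A ^ (s + 1)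
    by_cases haj : a j = 0
    · rw [divX_monomial_mul_of_eq_zero haj, pow_succ']
      exact Ideal.mul_mem_mul (monomial_mem_monomialIdeal ha) (ih p hp)
    · rw [divX_monomial_mul_of_ne_zero haj]
      exact Ideal.mul_mem_left _ _ hp

lemma monomialIdeal_le_span_X (hA : monomialIdeal k A ≠ ⊤) :
    monomialIdeal k A ≤ Ideal.span (Set.range X) := by
  refine Ideal.span_le.2 (Set.forall_mem_image.2 fun a ha => ?_)
  obtain ⟨j, haj⟩ : ∃ j, a j ≠ 0 := by
    by_contra! ha₀
    obtain rfl : a = 0 := Finsupp.ext ha₀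
    exact hA ((Ideal.eq_top_iff_one _).2 (monomial_mem_monomialIdeal ha))
  rw [← X_mul_monomial_tsub haj]
  exact Ideal.mul_mem_right _ _ (Ideal.subset_span ⟨j, rfl⟩)

end Monomial

end SmallType

end

open SmallType in
theorem mainTheorem3_general {k : Type u} [CommRing k] {σ : Type v} [Finite σ]
    {A : Set (σ →₀ ℕ)} (hA : monomialIdeal k A ≠ ⊤) (s i : ℕ) :
    ((Tor (ModuleCat.{max u v} (MvPolynomial σ k)) i).obj (ModuleCat.of _
      (MvPolynomial σ k ⧸ Ideal.span (Set.range (MvPolynomial.X : σ → MvPolynomial σ k))))).map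
      (ModuleCat.ofHom (Submodule.inclusion
        (Ideal.pow_le_pow_right s.le_succ : monomialIdeal k A ^ (s + 1) ≤ monomialIdeal k A ^ s)))
      = 0 :=
  tor_inclusion_eq_zero_of_isDivision.{u, v, max u v} isDivision_divX _
    ((Ideal.pow_le_self s.succ_ne_zero).trans (monomialIdeal_le_span_X hA))
    (X_mul_divX_mem_monomialIdeal_pow · (s + 1)) (divX_mem_monomialIdeal_pow · s) i

theorem mainTheorem3 {k : Type u} [Field k] {m : ℕ} (I : Ideal (MvPolynomial (Fin m) k))
    (hmon : SmallType.IsMonomialIdeal I) (hproper : I ≠ ⊤) :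
    SmallType.IsOfSmallType I := by
  obtain ⟨A, rfl⟩ := hmon
  intro s hs i
  obtain ⟨s, rfl⟩ := Nat.exists_eq_add_of_le' hs
  exact mainTheorem3_general hproper s i
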